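/- For $W\in\mathbb R^{r\times s}$ let $\|W\|_{q,p}$ be the $\ell_p$ norm of the vector $(\|W_{:,1}\|_q,\dots,\|W_{:,s}\|_q)$ of the $\ell_q$ norms of the columns of $W$. Fix $d,k,T,m\in\mathbb N$ with $d\ge 1$, $T\ge1$, $m>d$ and $m>\ln(2d)$, an index $[CLS]\in\{1,\dots,T\}$, an $L_\sigma$-Lipschitz function $\sigma:\mathbb R\to\mathbb R$ with $\sigma(0)=0$ (applied entrywise), and bounds $B_w,B_{W_c},B_{W_v}\ge0$, $B_{W_{QK}},B_x>0$. For $X\in\mathbb R^{T\times d}$ let $x_{[CLS]}\in\mathbb R^d$ be its row with index $[CLS]$, and consider the single-layer Transformers $$f_{w,W_c,W_v,W_{QK}}(X)=w^\top W_c^\top\,\sigma\bigl(W_v^\top X^\top\operatorname{softmax}(XW_{QK}\,x_{[CLS]})\bigr),$$ where $w\in\mathbb R^d$, $W_c\in\mathbb R^{k\times d}$, $W_v\in\mathbb R^{d\times k}$, $W_{QK}\in\mathbb R^{d\times d}$ satisfy $\|w\|_1\le B_w$, every column of $W_c$ (row of $W_c^\top$) has $\ell_1$ norm at most $B_{W_c}$,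 every column of $W_v$ (row of $W_v^\top$) has $\ell_1$ norm at most $B_{W_v}$, and $W_{QK}$ satisfies one of the norm bounds below. Let $X_{(1)},\dots,X_{(m)}\in\mathbb R^{T\times d}$ be inputs each of whose rows $x$ satisfies $\|x\|_1\le B_x$, and let $$\mathrm{Rad}_m=\frac1m\,\mathbb E_\epsilon\Bigl[\sup_{w,W_c,W_v,W_{QK}}\sum_{i=1}^m\epsilon_i f_{w,W_c,W_v,W_{QK}}(X_{(i)})\Bigr],$$ with $\epsilon_i$ i.i.d. uniform on $\{\pm1\}$. Put $B=B_wB_{W_c}L_\sigma B_{W_v}$ and $\ln_+ t=\max\{0,\ln t\}$. There is an absolute constant $c>0$ (independent of $T,d,k,m$, of $\sigma$, of the inputs and of all the norm bounds) such that in each of the following two cases the suprema are finite and $$\mathrm{Rad}_m\le c\,B\left(\frac{B_x^3\alpha}{\sqrt m}\left(1+\ln_+\!\left(\frac{\sqrt m-\sqrt{\ln(2d)}}{B_x^2\,\alpha}\right)\right)+B_x\sqrt{\frac{\ln(2d)}{m}}\right).$$ 1. The matrices $W_{QK}$ range over $\|W_{QK}\|_{1,\infty}\le B_{W_{QK}}$,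 and $\alpha=2B_{W_{QK}}\sqrt{d\log(2d+1)}$. 2. $d\ge2$, the matrices $W_{QK}$ range over $\|W_{QK}\|_{2,1}\le B_{W_{QK}}$, and $\alpha=2B_{W_{QK}}\sqrt{2\log d}$. Both bounds also hold when $W_{QK}$ is replaced by $W_{QK}^\top$ in the definition of $f$ (with the same constraint on $W_{QK}$). -/

import Mathlib

open scoped NNReal ENNReal Matrix BigOperators

noncomputable section

namespace AttnRad

/-- The vector norm `‖v‖_q` on `ℝ^n`, for `q ∈ [1, ∞]`. -/
def vecNorm {n : ℕ} (q : ℝ≥0∞) (v : Fin n → ℝ) : ℝ := ‖WithLp.toLp q v‖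

/-- The matrix norm `‖W‖_{q,p}`: the `ℓ_p` norm of the vector of the `ℓ_q` norms of the columns. -/
def mixedNorm {r s : ℕ} (q p : ℝ≥0∞) (W : Matrix (Fin r) (Fin s) ℝ) : ℝ :=
  vecNorm p (fun j => vecNorm q (fun i => W i j))

def softmax {n : ℕ} (v : Fin n → ℝ) : Fin n → ℝ :=
  fun i => Real.exp (v i) / ∑ j, Real.exp (v j)

/-- The correlation `∑ᵢ εᵢ f(xᵢ)` of `f` with a vector of signs on the sample `S = (x₁, …, xₙ)`. -/
def signedSum {E : Type*} {n : ℕ} (S : Fin n → E) (ε : Fin n → ℤˣ) (f : E → ℝ) : ℝ :=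
  ∑ i, ((ε i : ℤ) : ℝ) * f (S i)

/-- The empirical Rademacher complexity `(1/n) 𝔼_ε sup_{f ∈ F} ∑ᵢ εᵢ f(xᵢ)`; the expectation over
i.i.d. uniform signs is the average over all sign vectors. -/
def rademacher {E : Type*} {n : ℕ} (F : Set (E → ℝ)) (S : Fin n → E) : ℝ :=
  (1 / (n : ℝ)) * 𝔼 ε : Fin n → ℤˣ, sSup (signedSum S ε '' F)

/-- The Rademacher complexity of `F` on `S` is at most `r`; the suprema in its definition are
required to be finite. -/
def RademacherLE {E : Type*} {n : ℕ} (F : Set (E → ℝ)) (S : Fin n → E) (r : ℝ) : Prop :=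
  (∀ ε : Fin n → ℤˣ, BddAbove (signedSum S ε '' F)) ∧ rademacher F S ≤ r

/-- The scalar output `wᵀ W_cᵀ σ(W_vᵀ Xᵀ softmax(X W_QK x_cls))` of a single-layer Transformer,
where `x_cls` is the row of `X` with index `cls` and `σ` acts entrywise. -/
def transformer {d k T : ℕ} (σ : ℝ → ℝ) (cls : Fin T)
    (w : Fin d → ℝ) (Wc : Matrix (Fin k) (Fin d) ℝ) (Wv : Matrix (Fin d) (Fin k) ℝ)
    (Wqk : Matrix (Fin d) (Fin d) ℝ) (X : Matrix (Fin T) (Fin d) ℝ) : ℝ :=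
  w ⬝ᵥ (Wcᵀ *ᵥ fun a => σ ((Wvᵀ *ᵥ (Xᵀ *ᵥ softmax (X *ᵥ (Wqk *ᵥ X cls)))) a))

/-- The single-layer Transformers with `‖w‖₁ ≤ Bw`, with the columns of `W_c` and of `W_v` (the rows
of `W_cᵀ` and of `W_vᵀ`) bounded in `ℓ₁` by `Bc` and `Bv`, and with `W_QK ∈ 𝒲`. -/
def transformerClass {T : ℕ} (d k : ℕ) (σ : ℝ → ℝ) (cls : Fin T) (Bw Bc Bv : ℝ)
    (𝒲 : Set (Matrix (Fin d) (Fin d) ℝ)) : Set (Matrix (Fin T) (Fin d) ℝ → ℝ) :=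
  {f | ∃ (w : Fin d → ℝ) (Wc : Matrix (Fin k) (Fin d) ℝ) (Wv : Matrix (Fin d) (Fin k) ℝ)
      (Wqk : Matrix (Fin d) (Fin d) ℝ),
      vecNorm 1 w ≤ Bw ∧ mixedNorm 1 ∞ Wc ≤ Bc ∧ mixedNorm 1 ∞ Wv ≤ Bv ∧ Wqk ∈ 𝒲 ∧
      f = transformer σ cls w Wc Wv Wqk}

/-- The rate
`B (Bₓ³ α / √m · (1 + ln₊((√m - √ln(2d)) / (Bₓ² α))) + Bₓ √(ln(2d) / m))`, `ln₊ = max(0, ln)`. -/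
def rate (d m : ℕ) (B Bx α : ℝ) : ℝ :=
  B * (Bx ^ 3 * α / √(m : ℝ) *
        (1 + max 0 (Real.log ((√(m : ℝ) - √(Real.log (2 * d))) / (Bx ^ 2 * α))))
      + Bx * √(Real.log (2 * d) / m))

end AttnRad

end

/-!
The output of the network is `∑ₐ uₐ σ(⟨vₐ, y_W(X)⟩)`, where `u = W_c w` lies in the `ℓ₁` ball of
radius `B_w B_c`, the columns `vₐ` of `W_v` lie in the `ℓ₁` ball of radius `B_v`, and
`y_W(X) = Xᵀ softmax(X W x_cls)`. The supremum over `u` reduces to a single neuron, up to sign; the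
Ledoux–Talagrand contraction principle removes `σ`; the supremum over `v` then reduces to a single
signed coordinate of `y_W`. What remains is `𝔼 sup_W ‖∑ᵢ εᵢ y_W(Xᵢ)‖_∞`
(`rademacherLE_transformerClass`).

This is bounded by chaining. The softmax is `4`-Lipschitz from `ℓ_∞` to `ℓ₁` whatever the length
`T`, and `|xᵀ (W - W') z| ≤ Bₓ² max |Wᵢⱼ - W'ᵢⱼ|` for `x`, `z` in the `ℓ₁` ball of radius `Bₓ`, so
that `y_W` is `4 Bₓ³`-Lipschitz for the entrywise maximum norm of `W`, uniformly over the sample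
(`abs_pooled_sub_le`). Covering the matrices themselves in that norm, instead of the scores on the
sample, is what makes the bound independent of `T`. Truncating the entries to multiples of `δ`
gives a net of integer matrices of small `ℓ₁` norm, and there are at most `(2d² + 1)^S` of norm at
most `S`; under either constraint the metric entropy is at most `α² / δ²`, and this is invariant
under transposition (`MaxEntropyLE`).

With entropy `A² / δ²`, `A = 4 Bₓ³ α`, every dyadic scale contributes the same amount `√m A` to
the chain, and the chain is stopped after about `ln₊ (Bₓ √m / A)` scales
(`expect_iSup_signedCoord_le`). The choice of a signed coordinate adds `ln(2d)` to the entropy at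
each scale, which sums to a geometric series. Finally `m > d` gives `ln(2d) ≤ m / 2`, so that
`√m - √(ln(2d))` is at least `√m / 4`, and this factor `4` is the one in `A`.
-/

namespace AttnRad

open Finset

/-! ### Rademacher sums -/

/-- The correlation `∑ᵢ εᵢ aᵢ` of a vector with a vector of signs. -/
def corr {n : ℕ} (ε : Fin n → ℤˣ) (a : Fin n → ℝ) : ℝ := ∑ i, ((ε i : ℤ) : ℝ) * a i

theorem abs_sign (u : ℤˣ) : |((u : ℤ) : ℝ)| = 1 := by
  rcases Int.units_eq_one_or u with rfl | rfl <;> simp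

theorem abs_corr_le {n : ℕ} (ε : Fin n → ℤˣ) {a : Fin n → ℝ} {r : ℝ} (ha : ∀ i, |a i| ≤ r) :
    |corr ε a| ≤ n * r := by
  calc |corr ε a| ≤ ∑ i, |((ε i : ℤ) : ℝ) * a i| := abs_sum_le_sum_abs _ _
    _ ≤ ∑ _i : Fin n, r := by
        refine sum_le_sum fun i _ => ?_
        rw [abs_mul, abs_sign, one_mul]; exact ha i
    _ = n * r := by simp

theorem corr_sub {n : ℕ} (ε : Fin n → ℤˣ) (a b : Fin n → ℝ) :
    corr ε (a - b) = corr ε a - corr ε b := by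
  simp [corr, mul_sub, sum_sub_distrib]

theorem corr_zero {n : ℕ} (ε : Fin n → ℤˣ) : corr ε 0 = 0 := by simp [corr]

theorem corr_neg_left {n : ℕ} (ε : Fin n → ℤˣ) (a : Fin n → ℝ) : corr (-ε) a = -corr ε a := by
  simp [corr]

theorem corr_mul_left {n : ℕ} (ε : Fin n → ℤˣ) (c : ℝ) (a : Fin n → ℝ) :
    corr ε (fun i => c * a i) = c * corr ε a := by
  simp only [corr, mul_sum]
  exact sum_congr rfl fun i _ => by ring

theorem corr_sum_mul {n : ℕ} {κ : Type*} [Fintype κ] (ε : Fin n → ℤˣ) (c : κ → ℝ)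
    (a : κ → Fin n → ℝ) :
    corr ε (fun i => ∑ j, c j * a j i) = ∑ j, c j * corr ε (a j) := by
  simp only [corr, mul_sum]
  rw [sum_comm]
  exact sum_congr rfl fun j _ => sum_congr rfl fun i _ => by ring

theorem bddAbove_corr {ι : Type*} {n : ℕ} (ε : Fin n → ℤˣ) {a : ι → Fin n → ℝ} {r : ℝ}
    (ha : ∀ θ i, |a θ i| ≤ r) : BddAbove (Set.range fun θ => corr ε (a θ)) :=
  ⟨n * r, by rintro _ ⟨θ, rfl⟩; exact (abs_le.1 (abs_corr_le ε (ha θ))).2⟩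

theorem expect_mono {n : ℕ} {f g : (Fin n → ℤˣ) → ℝ} (h : ∀ ε, f ε ≤ g ε) :
    𝔼 ε, f ε ≤ 𝔼 ε, g ε := expect_le_expect fun ε _ => h ε

theorem expect_neg_signs {n : ℕ} (f : (Fin n → ℤˣ) → ℝ) : 𝔼 ε, f (-ε) = 𝔼 ε, f ε :=
  Fintype.expect_equiv (Equiv.neg _) _ _ fun _ => rfl

/-- Splitting off the first sign. -/
theorem expect_signs_succ {n : ℕ} (f : (Fin (n + 1) → ℤˣ) → ℝ) :
    𝔼 ε, f ε = 𝔼 ε : Fin n → ℤˣ, (f (Fin.cons 1 ε) + f (Fin.cons (-1) ε)) / 2 := by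
  have h : ∑ ε, f ε = ∑ ε : Fin n → ℤˣ, (f (Fin.cons 1 ε) + f (Fin.cons (-1) ε)) := by
    rw [← (Fin.consEquiv fun _ : Fin (n + 1) => ℤˣ).sum_comp, Fintype.sum_prod_type_right]
    refine sum_congr rfl fun ε _ => ?_
    rw [UnitsInt.univ]
    simp [Fin.consEquiv]
  rw [Fintype.expect_eq_sum_div_card, Fintype.expect_eq_sum_div_card, h, ← sum_div]
  simp [pow_succ]
  field_simp

theorem corr_cons {n : ℕ} (u : ℤˣ) (ε : Fin n → ℤˣ) (a : Fin (n + 1) → ℝ) :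
    corr (Fin.cons u ε) a = ((u : ℤ) : ℝ) * a 0 + corr ε (fun i => a i.succ) := by
  simp [corr, Fin.sum_univ_succ]

/-! ### Massart's finite class lemma -/

/-- The moment generating function of a Rademacher sum is sub-Gaussian. -/
theorem expect_exp_corr_le {n : ℕ} (a : Fin n → ℝ) :
    𝔼 ε, Real.exp (corr ε a) ≤ Real.exp ((∑ i, a i ^ 2) / 2) := by
  induction n with
  | zero => simp [corr]
  | succ n ih =>
    rw [expect_signs_succ]
    have h : ∀ ε : Fin n → ℤˣ,
        (Real.exp (corr (Fin.cons 1 ε) a) + Real.exp (corr (Fin.cons (-1) ε) a)) / 2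
          = Real.cosh (a 0) * Real.exp (corr ε fun i => a i.succ) := by
      intro ε
      rw [corr_cons, corr_cons, Real.cosh_eq, Real.exp_add, Real.exp_add]
      push_cast
      ring_nf
    simp_rw [h]
    rw [← mul_expect, Fin.sum_univ_succ, add_div, Real.exp_add]
    exact mul_le_mul (Real.cosh_le_exp_half_sq _) (ih _)
      (expect_nonneg fun _ _ => (Real.exp_pos _).le) (Real.exp_pos _).le

/-- Massart's finite class lemma, for a family of vectors taking its values in a finite set. -/
theorem expect_iSup_corr_le_of_finset {ι : Type*} [Nonempty ι] {n : ℕ} (hn : 0 < n)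
    (b : ι → Fin n → ℝ) (A : Finset (Fin n → ℝ)) (hA : ∀ θ, b θ ∈ A) {r D : ℝ} (hr : 0 < r)
    (hD : 0 < D) (hcard : (A.card : ℝ) ≤ Real.exp D) (hb : ∀ θ i, |b θ i| ≤ r) :
    𝔼 ε, ⨆ θ, corr ε (b θ) ≤ r * √(2 * n * D) := by
  classical
  have hn' : (0 : ℝ) < n := by exact_mod_cast hn
  set A' := A.filter fun a => ∀ i, |a i| ≤ r
  have hA'card : (A'.card : ℝ) ≤ Real.exp D :=
    le_trans (by exact_mod_cast card_filter_le _ _) hcard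
  set s := √(2 * n * D) with hs
  have hspos : 0 < s := Real.sqrt_pos.2 (by positivity)
  have hsq : s ^ 2 = 2 * n * D := Real.sq_sqrt (by positivity)
  -- the value of `l` that minimizes `D / l + l n r² / 2`
  set l := s / (n * r) with hl
  have hlpos : 0 < l := by positivity
  set E := D + l ^ 2 * (n * r ^ 2) / 2 with hE
  -- the tangent inequality `x + 1 ≤ exp x` takes the place of Jensen's inequality
  have key : ∀ ε : Fin n → ℤˣ, l * ⨆ θ, corr ε (b θ) ≤
      E - 1 + ∑ a ∈ A', Real.exp (corr ε fun i => l * a i) * Real.exp (-E) := by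
    intro ε
    rw [Real.mul_iSup_of_nonneg hlpos.le]
    refine ciSup_le fun θ => ?_
    have h1 := Real.add_one_le_exp (l * corr ε (b θ) - E)
    have h2 : Real.exp (corr ε fun i => l * b θ i) * Real.exp (-E) ≤
        ∑ a ∈ A', Real.exp (corr ε fun i => l * a i) * Real.exp (-E) :=
      single_le_sum (f := fun a : Fin n → ℝ => Real.exp (corr ε fun i => l * a i) * Real.exp (-E))
        (fun _ _ => by positivity) (mem_filter.2 ⟨hA θ, hb θ⟩)
    rw [corr_mul_left, ← Real.exp_add, ← sub_eq_add_neg] at h2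
    linarith
  have h1 : l * 𝔼 ε, ⨆ θ, corr ε (b θ) ≤ E := by
    rw [mul_expect]
    refine (expect_mono key).trans ?_
    rw [expect_add_distrib, expect_const univ_nonempty, expect_sum_comm]
    have h3 : ∀ a ∈ A', 𝔼 ε : Fin n → ℤˣ, Real.exp (corr ε fun i => l * a i) * Real.exp (-E)
        ≤ Real.exp (-D) := by
      intro a ha
      rw [← expect_mul]
      refine (mul_le_mul_of_nonneg_right (expect_exp_corr_le _) (Real.exp_pos _).le).trans ?_
      rw [← Real.exp_add]
      refine Real.exp_le_exp.2 ?_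
      have h4 : ∑ i, (l * a i) ^ 2 ≤ ∑ _i : Fin n, l ^ 2 * r ^ 2 := by
        refine sum_le_sum fun i _ => ?_
        rw [mul_pow]
        exact mul_le_mul_of_nonneg_left (sq_le_sq.2 (by
          rw [abs_of_pos hr]; exact (mem_filter.1 ha).2 i)) (sq_nonneg _)
      rw [sum_const, card_univ, Fintype.card_fin, nsmul_eq_mul] at h4
      rw [hE]
      linarith
    have h5 : (A'.card : ℝ) * Real.exp (-D) ≤ 1 := by
      refine (mul_le_mul_of_nonneg_right hA'card (Real.exp_pos _).le).trans ?_
      rw [← Real.exp_add]; simp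
    have h6 := sum_le_card_nsmul A' _ _ h3
    rw [nsmul_eq_mul] at h6
    linarith
  have h2 : E = l * (r * s) := by
    rw [hE, hl]
    have : D = s ^ 2 / (2 * n) := by rw [hsq]; field_simp
    rw [this]
    field_simp
    ring
  rw [h2] at h1
  exact le_of_mul_le_mul_left h1 hlpos

/-! ### The contraction principle -/

/-- One coordinate of the contraction principle: conditionally on the other signs, averaging over a
single sign, the Lipschitz function may be replaced by the linear one. -/
theorem iSup_add_iSup_contraction {ι : Type*} [Nonempty ι] {σ : ℝ → ℝ} {L : ℝ≥0}
    (hσ : LipschitzWith L σ) (h a : ι → ℝ)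
    (h₁ : BddAbove (Set.range fun θ => h θ + L * a θ))
    (h₂ : BddAbove (Set.range fun θ => h θ - L * a θ)) :
    (⨆ θ, (h θ + σ (a θ))) + ⨆ θ, (h θ - σ (a θ))
      ≤ (⨆ θ, (h θ + L * a θ)) + ⨆ θ, (h θ - L * a θ) := by
  rw [← le_sub_iff_add_le]
  refine ciSup_le fun θ => ?_
  rw [le_sub_comm]
  refine ciSup_le fun θ' => ?_
  have h3 := hσ.dist_le_mul (a θ) (a θ')
  rw [Real.dist_eq, Real.dist_eq] at h3
  have h4 := le_abs_self (σ (a θ) - σ (a θ'))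
  rcases abs_cases (a θ - a θ') with ⟨h5, _⟩ | ⟨h5, _⟩
  · have h6 := le_ciSup h₁ θ
    have h7 := le_ciSup h₂ θ'
    rw [h5] at h3
    linarith
  · have h6 := le_ciSup h₁ θ'
    have h7 := le_ciSup h₂ θ
    rw [h5] at h3
    linarith

/-- The contraction principle with an additive offset `g`, which carries the induction on the number
of signs. -/
theorem expect_iSup_add_contraction {ι : Type*} [Nonempty ι] {σ : ℝ → ℝ} {L : ℝ≥0}
    (hσ : LipschitzWith L σ) {n : ℕ} (g : ι → ℝ) (a : ι → Fin n → ℝ) {G M : ℝ}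
    (hg : ∀ θ, |g θ| ≤ G) (ha : ∀ θ i, |a θ i| ≤ M) :
    𝔼 ε, ⨆ θ, (g θ + corr ε fun i => σ (a θ i)) ≤
      𝔼 ε, ⨆ θ, (g θ + corr ε fun i => L * a θ i) := by
  induction n generalizing g G with
  | zero => simp [corr]
  | succ n ih =>
    have hM : ∀ θ, |L * a θ 0| ≤ L * M := fun θ => by
      rw [abs_mul, abs_of_nonneg L.coe_nonneg]
      exact mul_le_mul_of_nonneg_left (ha θ 0) L.coe_nonneg
    have hσM : ∀ θ, |σ (a θ 0)| ≤ |σ 0| + L * M := fun θ => by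
      have h1 := hσ.dist_le_mul (a θ 0) 0
      rw [Real.dist_eq, Real.dist_eq, sub_zero] at h1
      have h2 := mul_le_mul_of_nonneg_left (ha θ 0) L.coe_nonneg
      have h3 := abs_sub_abs_le_abs_sub (σ (a θ 0)) (σ 0)
      linarith
    have hplus := ih (fun θ => g θ + σ (a θ 0)) (fun θ i => a θ i.succ)
      (G := G + (|σ 0| + L * M)) (fun θ => (abs_add_le _ _).trans (add_le_add (hg θ) (hσM θ)))
      (fun θ i => ha θ _)
    have hminus := ih (fun θ => g θ - σ (a θ 0)) (fun θ i => a θ i.succ)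
      (G := G + (|σ 0| + L * M)) (fun θ => (abs_sub _ _).trans (add_le_add (hg θ) (hσM θ)))
      (fun θ i => ha θ _)
    rw [expect_signs_succ, expect_signs_succ]
    simp only [corr_cons, Units.val_one, Units.val_neg, Int.cast_one, Int.cast_neg, one_mul,
      neg_mul, ← add_assoc, ← sub_eq_add_neg] at hplus hminus ⊢
    rw [← expect_div, ← expect_div, expect_add_distrib, expect_add_distrib]
    refine div_le_div_of_nonneg_right ((add_le_add hplus hminus).trans ?_) zero_le_two
    rw [← expect_add_distrib, ← expect_add_distrib]
    refine expect_mono fun ε => ?_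
    have hc : ∀ θ, |corr ε fun i => L * a θ i.succ| ≤ n * (L * M) := fun θ =>
      abs_corr_le ε fun i => by
        rw [abs_mul, abs_of_nonneg L.coe_nonneg]
        exact mul_le_mul_of_nonneg_left (ha θ _) L.coe_nonneg
    have := iSup_add_iSup_contraction hσ (fun θ => g θ + corr ε fun i => L * a θ i.succ)
      (fun θ => a θ 0)
      ⟨G + n * (L * M) + L * M, by
        rintro _ ⟨θ, rfl⟩
        have h1 := (abs_le.1 (hg θ)).2
        have h2 := (abs_le.1 (hc θ)).2
        have h3 := (abs_le.1 (hM θ)).2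
        simp only; linarith⟩
      ⟨G + n * (L * M) + L * M, by
        rintro _ ⟨θ, rfl⟩
        have h1 := (abs_le.1 (hg θ)).2
        have h2 := (abs_le.1 (hc θ)).2
        have h3 := (abs_le.1 (hM θ)).1
        simp only; linarith⟩
    simpa only [add_right_comm, add_sub_right_comm] using this

/-- The Ledoux–Talagrand contraction principle. -/
theorem expect_iSup_contraction {ι : Type*} [Nonempty ι] {σ : ℝ → ℝ} {L : ℝ≥0}
    (hσ : LipschitzWith L σ) {n : ℕ} (a : ι → Fin n → ℝ) {M : ℝ} (ha : ∀ θ i, |a θ i| ≤ M) :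
    𝔼 ε, ⨆ θ, (corr ε fun i => σ (a θ i)) ≤ L * 𝔼 ε, ⨆ θ, corr ε (a θ) := by
  have h := expect_iSup_add_contraction hσ (fun _ => 0) a (G := 0) (by simp) ha
  simp only [zero_add, corr_mul_left] at h
  rw [mul_expect]
  simpa only [Real.mul_iSup_of_nonneg L.coe_nonneg] using h

/-! ### Chaining -/

/-- Finite chaining: the supremum of the process is bounded by the increments along a chain of
approximations `p 0 = 0, p 1, …, p K`, plus the error of the last one. -/
theorem expect_iSup_corr_le_of_chain {ι : Type*} [Nonempty ι] {n : ℕ} (hn : 0 < n)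
    (a : ι → Fin n → ℝ) (p : ℕ → ι → Fin n → ℝ) (h0 : ∀ θ, p 0 θ = 0)
    {r D : ℕ → ℝ} (hr : ∀ k, 0 < r k) (hD : ∀ k, 0 < D k) (A : ℕ → Finset (Fin n → ℝ))
    (hA : ∀ k θ, p (k + 1) θ - p k θ ∈ A k) (hcard : ∀ k, ((A k).card : ℝ) ≤ Real.exp (D k))
    (hinc : ∀ k θ i, |p (k + 1) θ i - p k θ i| ≤ r k) (K : ℕ) {ρ : ℝ}
    (hρ : ∀ θ i, |a θ i - p K θ i| ≤ ρ) :
    𝔼 ε, ⨆ θ, corr ε (a θ) ≤ ∑ k ∈ range K, r k * √(2 * n * D k) + n * ρ := by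
  have key : ∀ ε : Fin n → ℤˣ, ⨆ θ, corr ε (a θ) ≤
      ∑ k ∈ range K, (⨆ θ, corr ε (p (k + 1) θ - p k θ)) + n * ρ := by
    intro ε
    refine ciSup_le fun θ => ?_
    have h1 : corr ε (p K θ) = ∑ k ∈ range K, corr ε (p (k + 1) θ - p k θ) := by
      simp_rw [corr_sub]
      rw [sum_range_sub fun k => corr ε (p k θ), h0, corr_zero, sub_zero]
    have h2 : ∑ k ∈ range K, corr ε (p (k + 1) θ - p k θ) ≤
        ∑ k ∈ range K, ⨆ θ, corr ε (p (k + 1) θ - p k θ) :=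
      sum_le_sum fun k _ => le_ciSup (bddAbove_corr ε fun θ i => hinc k θ i) θ
    have h3 := (abs_le.1 (abs_corr_le ε (a := a θ - p K θ) (hρ θ))).2
    rw [corr_sub] at h3
    linarith
  refine (expect_mono key).trans ?_
  rw [expect_add_distrib, expect_const univ_nonempty, expect_sum_comm]
  gcongr with k _
  exact expect_iSup_corr_le_of_finset hn _ (A k) (hA k) (hr k) (hD k) (hcard k) fun θ i =>
    hinc k θ i

/-- The family of the signed coordinates `s • y θ j`, whose supremum is the `ℓ_∞` norm. -/
def signedCoord {ι κ : Type*} {n : ℕ} (y : ι → κ → Fin n → ℝ) (θ : ι × κ × ℤˣ) : Fin n → ℝ :=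
  fun i => ((θ.2.2 : ℤ) : ℝ) * y θ.1 θ.2.1 i

theorem abs_signedCoord {ι κ : Type*} {n : ℕ} (y : ι → κ → Fin n → ℝ) (θ : ι × κ × ℤˣ)
    (i : Fin n) : |signedCoord y θ i| = |y θ.1 θ.2.1 i| := by
  rw [signedCoord, abs_mul, abs_sign, one_mul]

/-- A dyadic form of Dudley's entropy bound for the `ℓ_∞` norm of a bounded process with `d`
coordinates: the covering numbers `exp (A² / δ²)` contribute the same amount at every scale, while
the `2d` choices of a signed coordinate contribute a geometric series. -/
theorem expect_iSup_signedCoord_le_dyadic {ι : Type*} [Nonempty ι] {n d : ℕ} (hn : 0 < n)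
    (hd : 0 < d) (y : ι → Fin d → Fin n → ℝ) {A b : ℝ} (hA : 0 < A) (hb : 0 < b)
    (hy : ∀ θ j i, |y θ j i| ≤ b)
    (hcover : ∀ δ > 0, ∃ (q : ι → Fin d → Fin n → ℝ) (F : Finset (Fin d → Fin n → ℝ)),
      (∀ θ, q θ ∈ F) ∧ (F.card : ℝ) ≤ Real.exp (A ^ 2 / δ ^ 2) ∧
      ∀ θ j i, |q θ j i - y θ j i| ≤ δ) (K : ℕ) :
    𝔼 ε, ⨆ θ, corr ε (signedCoord y θ) ≤
      9 * b * √(n * Real.log (2 * d)) + 6 * (K + 1) * (√n * A) + n * (b / 2 ^ K) := by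
  classical
  have : Nonempty (Fin d) := ⟨⟨0, hd⟩⟩
  have hlog : 0 < Real.log (2 * d) := Real.log_pos (by
    have : (1 : ℝ) ≤ d := by exact_mod_cast hd
    linarith)
  have hδ : ∀ k : ℕ, 0 < b / 2 ^ k := fun k => by positivity
  choose q F hqF hFcard hqy using fun k : ℕ => hcover (b / 2 ^ k) (hδ k)
  -- the chain starts at `0`, so that its `k`-th element is the approximation at scale `2 b / 2 ^ k`
  obtain ⟨Q, hQ0, hQs⟩ : ∃ Q : ℕ → ι → Fin d → Fin n → ℝ, Q 0 = 0 ∧ ∀ k, Q (k + 1) = q k :=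
    ⟨fun k => Nat.casesOn k 0 q, rfl, fun _ => rfl⟩
  obtain ⟨G, hG0, hGs⟩ : ∃ G : ℕ → Finset (Fin d → Fin n → ℝ), G 0 = {0} ∧ ∀ k, G (k + 1) = F k :=
    ⟨fun k => Nat.casesOn k {0} F, rfl, fun _ => rfl⟩
  have hQG : ∀ k θ, Q k θ ∈ G k := by
    rintro (_ | k) θ
    · rw [hQ0, hG0]; exact mem_singleton.2 rfl
    · rw [hQs, hGs]; exact hqF k θ
  have hFcard' : ∀ k, ((F k).card : ℝ) ≤ Real.exp (A ^ 2 * 4 ^ k / b ^ 2) := by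
    intro k
    have : A ^ 2 / (b / 2 ^ k) ^ 2 = A ^ 2 * 4 ^ k / b ^ 2 := by
      rw [show (4 : ℝ) = 2 ^ 2 by norm_num, ← pow_mul, mul_comm 2 k, pow_mul]
      field_simp
    exact this ▸ hFcard k
  have hGcard : ∀ k, ((G k).card : ℝ) ≤ Real.exp (A ^ 2 * 4 ^ k / b ^ 2) := by
    rintro (_ | k)
    · rw [hG0, card_singleton, Nat.cast_one]
      exact Real.one_le_exp (by positivity)
    · rw [hGs]
      refine (hFcard' k).trans (Real.exp_le_exp.2 ?_)
      gcongr
      · norm_num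
      · omega
  have hinc : ∀ k θ j i, |Q (k + 1) θ j i - Q k θ j i| ≤ 3 * b / 2 ^ k := by
    rintro (_ | k) θ j i
    · have h1 := abs_le.1 (hqy 0 θ j i)
      have h2 := abs_le.1 (hy θ j i)
      rw [hQs, hQ0]
      simp only [pow_zero, div_one, Pi.zero_apply, sub_zero] at h1 ⊢
      exact abs_le.2 ⟨by linarith, by linarith⟩
    · have h1 := abs_le.1 (hqy (k + 1) θ j i)
      have h2 := abs_le.1 (hqy k θ j i)
      have h3 : b / 2 ^ k = 2 * (b / 2 ^ (k + 1)) := by rw [pow_succ]; field_simp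
      have h4 : 3 * b / 2 ^ (k + 1) = 3 * (b / 2 ^ (k + 1)) := by ring
      rw [h3] at h2
      rw [h4, hQs, hQs]
      exact abs_le.2 ⟨by linarith, by linarith⟩
  let S : ℕ → Finset (Fin n → ℝ) := fun k =>
    ((F k ×ˢ G k) ×ˢ (univ : Finset (Fin d × ℤˣ))).image fun z =>
      fun i => ((z.2.2 : ℤ) : ℝ) * (z.1.1 z.2.1 i - z.1.2 z.2.1 i)
  have hScard : ∀ k, ((S k).card : ℝ) ≤
      Real.exp (Real.log (2 * d) + 2 * (A ^ 2 * 4 ^ k / b ^ 2)) := by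
    intro k
    have h1 : ((S k).card : ℝ) ≤ (F k).card * (G k).card * (d * 2) := by
      have := card_image_le (s := (F k ×ˢ G k) ×ˢ (univ : Finset (Fin d × ℤˣ)))
        (f := fun z => fun i => ((z.2.2 : ℤ) : ℝ) * (z.1.1 z.2.1 i - z.1.2 z.2.1 i))
      rw [card_product, card_product, card_univ, Fintype.card_prod, Fintype.card_fin,
        Fintype.card_units_int] at this
      exact_mod_cast this
    refine h1.trans ?_
    rw [Real.exp_add, Real.exp_log (by positivity)]
    have h2 : Real.exp (2 * (A ^ 2 * 4 ^ k / b ^ 2)) =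
        Real.exp (A ^ 2 * 4 ^ k / b ^ 2) * Real.exp (A ^ 2 * 4 ^ k / b ^ 2) := by
      rw [← Real.exp_add]; congr 1; ring
    rw [h2]
    calc _ ≤ Real.exp (A ^ 2 * 4 ^ k / b ^ 2) * Real.exp (A ^ 2 * 4 ^ k / b ^ 2) * (d * 2) := by
          gcongr; exacts [hFcard' k, hGcard k]
      _ = _ := by ring
  have hchain := expect_iSup_corr_le_of_chain hn (signedCoord y) (fun k => signedCoord (Q k))
    (fun θ => by ext i; simp [signedCoord, hQ0])
    (r := fun k => 3 * b / 2 ^ k) (D := fun k => Real.log (2 * d) + 2 * (A ^ 2 * 4 ^ k / b ^ 2))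
    (fun k => by positivity) (fun k => by positivity) S
    (fun k θ => mem_image.2 ⟨((Q (k + 1) θ.1, Q k θ.1), θ.2),
      mem_product.2 ⟨mem_product.2 ⟨hQs k ▸ hqF k θ.1, hQG k θ.1⟩, mem_univ _⟩, by
        ext i; simp [signedCoord, mul_sub]⟩)
    hScard
    (fun k θ i => by
      simp only [signedCoord]
      rw [← mul_sub, abs_mul, abs_sign, one_mul]
      exact hinc k _ _ i) (K + 1) (ρ := b / 2 ^ K)
    (fun θ i => by
      simp only [signedCoord]
      rw [← mul_sub, abs_mul, abs_sign, one_mul, abs_sub_comm]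
      rw [hQs]
      exact hqy K _ _ i)
  refine hchain.trans (add_le_add_left ?_ _)
  have hterm : ∀ k ∈ range (K + 1),
      3 * b / 2 ^ k * √(2 * n * (Real.log (2 * d) + 2 * (A ^ 2 * 4 ^ k / b ^ 2))) ≤
        9 / 2 * b * √(n * Real.log (2 * d)) * (1 / 2) ^ k + 6 * (√n * A) := by
    intro k _
    have h1 : 2 * n * (Real.log (2 * d) + 2 * (A ^ 2 * 4 ^ k / b ^ 2)) ≤
        (3 / 2 * √(n * Real.log (2 * d)) + 2 * (√n * A * 2 ^ k / b)) ^ 2 := by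
      have h2 : √(n * Real.log (2 * d)) ^ 2 = n * Real.log (2 * d) := Real.sq_sqrt (by positivity)
      have h3 : (√n * A * 2 ^ k / b) ^ 2 = n * (A ^ 2 * 4 ^ k / b ^ 2) := by
        rw [div_pow, mul_pow, mul_pow, Real.sq_sqrt (by positivity), ← pow_mul, mul_comm k 2,
          pow_mul]
        norm_num
        ring
      have h4 : 0 ≤ √(n * Real.log (2 * d)) * (√n * A * 2 ^ k / b) := by positivity
      have h5 : 0 ≤ n * Real.log (2 * d) := by positivity
      have h6 : 0 ≤ n * (A ^ 2 * 4 ^ k / b ^ 2) := by positivity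
      linarith
    have h2 := Real.sqrt_le_sqrt h1
    rw [Real.sqrt_sq (by positivity)] at h2
    refine (mul_le_mul_of_nonneg_left h2 (by positivity)).trans (le_of_eq ?_)
    rw [one_div, inv_pow]
    field_simp
    ring
  refine (sum_le_sum hterm).trans ?_
  rw [sum_add_distrib, ← mul_sum, sum_const, card_range, nsmul_eq_mul]
  have hgeom := sum_geometric_two_le (K + 1)
  have h1 : 0 ≤ 9 / 2 * b * √(n * Real.log (2 * d)) := by positivity
  have h2 := mul_le_mul_of_nonneg_left hgeom h1
  push_cast
  linarith

/-- The optimized form: the chain is stopped at the scale `A / √n`, below which the approximation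
error is negligible, hence after `ln₊ (b √n / A)` steps up to a constant. -/
theorem expect_iSup_signedCoord_le {ι : Type*} [Nonempty ι] {n d : ℕ} (hn : 0 < n)
    (hd : 0 < d) (y : ι → Fin d → Fin n → ℝ) {A b : ℝ} (hA : 0 < A) (hb : 0 < b)
    (hy : ∀ θ j i, |y θ j i| ≤ b)
    (hcover : ∀ δ > 0, ∃ (q : ι → Fin d → Fin n → ℝ) (F : Finset (Fin d → Fin n → ℝ)),
      (∀ θ, q θ ∈ F) ∧ (F.card : ℝ) ≤ Real.exp (A ^ 2 / δ ^ 2) ∧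
      ∀ θ j i, |q θ j i - y θ j i| ≤ δ) :
    𝔼 ε, ⨆ θ, corr ε (signedCoord y θ) ≤
      13 * (√n * A * (1 + max 0 (Real.log (b * √n / A))) + b * √(n * Real.log (2 * d))) := by
  have hn' : (0 : ℝ) < n := by exact_mod_cast hn
  set R := b * √n / A with hR
  have hRpos : 0 < R := by positivity
  set K := ⌈max 0 (Real.log R) / Real.log 2⌉₊ with hK
  have hl2 : (1 / 2 : ℝ) < Real.log 2 := by linarith [Real.log_two_gt_d9]
  have hK1 : (K : ℝ) ≤ 2 * max 0 (Real.log R) + 1 := by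
    have h1 : 0 ≤ max 0 (Real.log R) := le_max_left _ _
    refine (Nat.ceil_lt_add_one (by positivity)).le.trans (add_le_add_left ?_ _)
    rw [div_le_iff₀ (by linarith)]
    nlinarith
  have hK2 : R ≤ 2 ^ K := by
    have h1 : max 0 (Real.log R) ≤ K * Real.log 2 :=
      (div_le_iff₀ (by linarith)).1 (Nat.le_ceil _)
    rw [← Real.log_le_log_iff hRpos (by positivity), Real.log_pow]
    exact (le_max_right _ _).trans h1
  have h1 : n * (b / 2 ^ K) ≤ √n * A := by
    rw [hR, div_le_iff₀ hA] at hK2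
    rw [← mul_div_assoc, div_le_iff₀ (by positivity)]
    calc n * b = √n * (b * √n) := by
          rw [mul_left_comm, Real.mul_self_sqrt hn'.le, mul_comm]
      _ ≤ √n * (2 ^ K * A) := by gcongr
      _ = _ := by ring
  refine (expect_iSup_signedCoord_le_dyadic hn hd y hA hb hy hcover K).trans ?_
  have h2 : 0 ≤ √n * A := by positivity
  have h3 : 0 ≤ b * √(n * Real.log (2 * d)) := by positivity
  have h4 := mul_le_mul_of_nonneg_right hK1 h2
  have h5 : 0 ≤ √n * A * max 0 (Real.log R) := mul_nonneg h2 (le_max_left _ _)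
  linarith

/-! ### Mixed norms -/

theorem vecNorm_one_eq {n : ℕ} (v : Fin n → ℝ) : vecNorm 1 v = ∑ i, |v i| := by
  simp [vecNorm, PiLp.norm_eq_of_L1]

theorem vecNorm_two_sq {n : ℕ} (v : Fin n → ℝ) : vecNorm 2 v ^ 2 = ∑ i, v i ^ 2 := by
  simp [vecNorm, EuclideanSpace.norm_sq_eq]

theorem vecNorm_nonneg {n : ℕ} (q : ℝ≥0∞) (hq : 1 ≤ q) (v : Fin n → ℝ) : 0 ≤ vecNorm q v := by
  have : Fact (1 ≤ q) := ⟨hq⟩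
  exact norm_nonneg _

theorem sum_abs_col_le {r s : ℕ} {W : Matrix (Fin r) (Fin s) ℝ} {B : ℝ}
    (h : mixedNorm 1 ∞ W ≤ B) (j : Fin s) : ∑ i, |W i j| ≤ B := by
  rw [← vecNorm_one_eq fun i => W i j]
  have h1 := PiLp.norm_apply_le (p := ∞) (WithLp.toLp ∞ fun j => vecNorm 1 fun i => W i j) j
  exact (le_abs_self _).trans (h1.trans h)

theorem sum_sq_le_of_mixedNorm {r s : ℕ} {W : Matrix (Fin r) (Fin s) ℝ} {B : ℝ}
    (h : mixedNorm 2 1 W ≤ B) : ∑ j, ∑ i, W i j ^ 2 ≤ B ^ 2 := by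
  have h0 : ∀ j, 0 ≤ vecNorm 2 fun i => W i j := fun j => vecNorm_nonneg 2 (by norm_num) _
  rw [mixedNorm, vecNorm_one_eq] at h
  simp only [abs_of_nonneg (h0 _)] at h
  calc ∑ j, ∑ i, W i j ^ 2 = ∑ j, (vecNorm 2 fun i => W i j) ^ 2 := by simp_rw [vecNorm_two_sq]
    _ ≤ ∑ j, B * vecNorm 2 fun i => W i j := sum_le_sum fun j _ => by
        rw [pow_two]
        exact mul_le_mul_of_nonneg_right
          ((single_le_sum (fun j _ => h0 j) (mem_univ j)).trans h) (h0 j)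
    _ ≤ B ^ 2 := by
        rw [← mul_sum, pow_two]
        exact mul_le_mul_of_nonneg_left h ((sum_nonneg fun j _ => h0 j).trans h)

/-! ### Metric entropy of the attention matrices -/

/-- Rounding towards zero. -/
noncomputable def trunc (t : ℝ) : ℤ := if 0 ≤ t then ⌊t⌋ else ⌈t⌉

theorem abs_trunc_le (t : ℝ) : ((trunc t).natAbs : ℝ) ≤ |t| := by
  rw [Nat.cast_natAbs, Int.cast_abs, trunc]
  split_ifs with h
  · rw [abs_of_nonneg h, abs_of_nonneg (by exact_mod_cast Int.floor_nonneg.2 h)]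
    exact Int.floor_le t
  · push Not at h
    rw [abs_of_neg h, abs_of_nonpos (by exact_mod_cast Int.ceil_nonpos.2 h.le)]
    linarith [Int.le_ceil t]

theorem abs_trunc_sub_le (t : ℝ) : |(trunc t : ℝ) - t| ≤ 1 := by
  rw [trunc]
  split_ifs with h
  · exact abs_le.2 ⟨by linarith [Int.lt_floor_add_one t], by linarith [Int.floor_le t]⟩
  · exact abs_le.2 ⟨by linarith [Int.le_ceil t], by linarith [Int.ceil_lt_add_one t]⟩

/-- The integer points of an `ℓ₁` ball of radius `S` are sums of `S` vectors from `{0, ±eᵢ}`. -/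
theorem exists_finset_int_ball (κ : Type*) [Fintype κ] (S : ℕ) :
    ∃ N : Finset (κ → ℤ), (∀ v : κ → ℤ, ∑ i, (v i).natAbs ≤ S → v ∈ N) ∧
      N.card ≤ (2 * Fintype.card κ + 1) ^ S := by
  classical
  induction S with
  | zero =>
    refine ⟨{0}, fun v hv => mem_singleton.2 (funext fun i => ?_), by simp⟩
    have := (sum_eq_zero_iff.1 (Nat.le_zero.1 hv)) i (mem_univ i)
    exact Int.natAbs_eq_zero.1 this
  | succ S ih =>
    obtain ⟨N, hN, hc⟩ := ih
    let step : Option (κ × ℤˣ) → κ → ℤ := fun o => o.elim 0 fun z => Pi.single z.1 (z.2 : ℤ)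
    refine ⟨(N ×ˢ (univ : Finset (Option (κ × ℤˣ)))).image fun z => z.1 + step z.2, ?_, ?_⟩
    · intro v hv
      by_cases h0 : v = 0
      · exact mem_image.2 ⟨(0, none), mem_product.2 ⟨hN 0 (by simp), mem_univ _⟩,
          by simp [step, h0]⟩
      · obtain ⟨i, hi⟩ := Function.ne_iff.1 h0
        have hi : v i ≠ 0 := hi
        obtain ⟨u, hu⟩ : ∃ u : ℤˣ, (v i - u).natAbs + 1 = (v i).natAbs := by
          rcases lt_or_gt_of_ne hi with h | h
          · exact ⟨-1, by push_cast; omega⟩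
          · exact ⟨1, by push_cast; omega⟩
        refine mem_image.2 ⟨(v - Pi.single i (u : ℤ), some (i, u)),
          mem_product.2 ⟨hN _ ?_, mem_univ _⟩, by simp [step]⟩
        rw [← add_sum_erase _ _ (mem_univ i)] at hv ⊢
        have h1 : ∑ j ∈ univ.erase i, ((v - Pi.single i (u : ℤ) : κ → ℤ) j).natAbs =
            ∑ j ∈ univ.erase i, (v j).natAbs :=
          sum_congr rfl fun j hj => by simp [Pi.single_eq_of_ne (ne_of_mem_erase hj)]
        rw [h1]
        simp only [Pi.sub_apply, Pi.single_eq_same]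
        omega
    · refine card_image_le.trans ?_
      rw [card_product, card_univ, Fintype.card_option, Fintype.card_prod,
        Fintype.card_units_int, pow_succ, mul_comm (Fintype.card κ) 2]
      exact Nat.mul_le_mul_right _ hc

/-- The metric entropy of `𝒲` in the entrywise maximum norm is at most `α² / δ²` at every scale
`δ`. The centres of the cover need not lie in `𝒲`. -/
def MaxEntropyLE {d : ℕ} (𝒲 : Set (Matrix (Fin d) (Fin d) ℝ)) (α : ℝ) : Prop :=
  ∀ δ > 0, ∃ (π : Matrix (Fin d) (Fin d) ℝ → Matrix (Fin d) (Fin d) ℝ)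
    (N : Finset (Matrix (Fin d) (Fin d) ℝ)), (N.card : ℝ) ≤ Real.exp (α ^ 2 / δ ^ 2) ∧
    ∀ W ∈ 𝒲, π W ∈ N ∧ ∀ i j, |π W i j - W i j| ≤ δ

theorem MaxEntropyLE.transpose {d : ℕ} {𝒲 : Set (Matrix (Fin d) (Fin d) ℝ)} {α : ℝ}
    (h : MaxEntropyLE 𝒲 α) : MaxEntropyLE {W | Wᵀ ∈ 𝒲} α := by
  classical
  intro δ hδ
  obtain ⟨π, N, hN, hW⟩ := h δ hδ
  refine ⟨fun W => (π Wᵀ)ᵀ, N.image Matrix.transpose,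
    le_trans (by exact_mod_cast card_image_le) hN, fun W hWm => ?_⟩
  obtain ⟨h1, h2⟩ := hW _ hWm
  exact ⟨mem_image_of_mem _ h1, fun i j => h2 j i⟩

/-- Truncating the entries of a matrix to multiples of `δ` gives a `δ`-net in the maximum norm,
whose size is controlled by the `ℓ₁` norm of the integer multiples. -/
theorem maxEntropyLE_of_trunc {d : ℕ} {𝒲 : Set (Matrix (Fin d) (Fin d) ℝ)} {α : ℝ}
    (h : ∀ δ > 0, ∃ S : ℕ, (∀ W ∈ 𝒲, ∑ j, ∑ i, (trunc (W i j / δ)).natAbs ≤ S) ∧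
      S * Real.log (2 * d ^ 2 + 1) ≤ α ^ 2 / δ ^ 2) :
    MaxEntropyLE 𝒲 α := by
  classical
  intro δ hδ
  obtain ⟨S, hS, hSα⟩ := h δ hδ
  obtain ⟨N, hN, hc⟩ := exists_finset_int_ball (Fin d × Fin d) S
  refine ⟨fun W => Matrix.of fun i j => δ * (trunc (W i j / δ) : ℝ),
    N.image fun v => Matrix.of fun i j => δ * (v (j, i) : ℝ), ?_, fun W hW => ⟨?_, fun i j => ?_⟩⟩
  · refine le_trans ?_ (Real.exp_le_exp.2 hSα)
    rw [mul_comm, Real.exp_mul, Real.exp_log (by positivity), Real.rpow_natCast]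
    have h1 := (card_image_le (f := fun v : Fin d × Fin d → ℤ =>
      (Matrix.of fun i j => δ * (v (j, i) : ℝ) : Matrix (Fin d) (Fin d) ℝ))).trans hc
    rw [Fintype.card_prod, Fintype.card_fin, ← pow_two] at h1
    exact_mod_cast h1
  · refine mem_image.2 ⟨fun z => trunc (W z.2 z.1 / δ), hN _ ?_, rfl⟩
    rw [Fintype.sum_prod_type]
    exact hS W hW
  · have h1 := mul_le_mul_of_nonneg_left (abs_trunc_sub_le (W i j / δ)) hδ.le
    rw [← abs_of_pos hδ, ← abs_mul, abs_of_pos hδ, mul_sub, mul_div_cancel₀ _ hδ.ne', mul_one] at h1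
    exact h1

/-- Each column of the truncated matrix has integer `ℓ₁` norm at most `⌊B / δ⌋ ≤ B² / δ²`; the
quadratic bound holds because the floor vanishes for `δ > B`. -/
theorem maxEntropyLE_mixedNorm_one_top {d : ℕ} (hd : 1 ≤ d) {B : ℝ} (hB : 0 < B) :
    MaxEntropyLE {W : Matrix (Fin d) (Fin d) ℝ | mixedNorm 1 ∞ W ≤ B}
      (2 * B * √(d * Real.log (2 * d + 1))) := by
  have hd' : (1 : ℝ) ≤ d := by exact_mod_cast hd
  have hlog : 0 ≤ Real.log (2 * d + 1) := Real.log_nonneg (by linarith)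
  refine maxEntropyLE_of_trunc fun δ hδ => ⟨d * ⌊B / δ⌋₊, fun W hW => ?_, ?_⟩
  · refine (sum_le_card_nsmul univ _ ⌊B / δ⌋₊ fun j _ => Nat.le_floor ?_).trans (by simp)
    push_cast
    calc ∑ i, ((trunc (W i j / δ)).natAbs : ℝ) ≤ ∑ i, |W i j| / δ :=
          sum_le_sum fun i _ => by
            have := abs_trunc_le (W i j / δ)
            rwa [abs_div, abs_of_pos hδ] at this
      _ ≤ B / δ := by
          rw [← sum_div]
          exact div_le_div_of_nonneg_right (sum_abs_col_le hW j) hδ.le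
  · have h1 : (⌊B / δ⌋₊ : ℝ) ≤ (B / δ) ^ 2 :=
      calc (⌊B / δ⌋₊ : ℝ) ≤ (⌊B / δ⌋₊ : ℝ) ^ 2 := by exact_mod_cast Nat.le_self_pow two_ne_zero _
        _ ≤ _ := pow_le_pow_left₀ (Nat.cast_nonneg _) (Nat.floor_le (by positivity)) 2
    have h2 : Real.log (2 * d ^ 2 + 1) ≤ 2 * Real.log (2 * d + 1) := by
      have h3 : Real.log ((2 * d + 1) ^ 2) = 2 * Real.log (2 * (d : ℝ) + 1) := by
        rw [Real.log_pow]; norm_num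
      rw [← h3]
      exact Real.log_le_log (by positivity) (by nlinarith)
    rw [mul_pow, mul_pow, Real.sq_sqrt (by positivity)]
    push_cast
    calc (d : ℝ) * ⌊B / δ⌋₊ * Real.log (2 * d ^ 2 + 1)
        ≤ d * (B / δ) ^ 2 * (2 * Real.log (2 * d + 1)) := by
          gcongr
          exact Real.log_nonneg (by nlinarith)
      _ ≤ 2 * (d * (B / δ) ^ 2 * (2 * Real.log (2 * d + 1))) := by
          have : 0 ≤ d * (B / δ) ^ 2 * (2 * Real.log (2 * d + 1)) := by positivity
          linarith
      _ = _ := by field_simp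

/-- The constraint implies `∑ Wᵢⱼ² ≤ B²`, and an integer is at most its square, so that the
truncated matrix has integer `ℓ₁` norm at most `B² / δ²`. -/
theorem maxEntropyLE_mixedNorm_two_one {d : ℕ} (hd : 2 ≤ d) {B : ℝ} :
    MaxEntropyLE {W : Matrix (Fin d) (Fin d) ℝ | mixedNorm 2 1 W ≤ B}
      (2 * B * √(2 * Real.log d)) := by
  have hd' : (2 : ℝ) ≤ d := by exact_mod_cast hd
  have hlog : 0 ≤ Real.log d := Real.log_nonneg (by linarith)
  refine maxEntropyLE_of_trunc fun δ hδ => ⟨⌊(B / δ) ^ 2⌋₊, fun W hW => Nat.le_floor ?_, ?_⟩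
  · push_cast
    calc ∑ j, ∑ i, ((trunc (W i j / δ)).natAbs : ℝ) ≤ ∑ j, ∑ i, W i j ^ 2 / δ ^ 2 := by
          refine sum_le_sum fun j _ => sum_le_sum fun i _ => ?_
          rw [← div_pow, ← sq_abs]
          calc ((trunc (W i j / δ)).natAbs : ℝ) ≤ ((trunc (W i j / δ)).natAbs : ℝ) ^ 2 := by
                exact_mod_cast Nat.le_self_pow two_ne_zero _
            _ ≤ _ := pow_le_pow_left₀ (Nat.cast_nonneg _) (abs_trunc_le _) 2
      _ ≤ (B / δ) ^ 2 := by
          simp_rw [← sum_div]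
          rw [div_pow]
          exact div_le_div_of_nonneg_right (sum_sq_le_of_mixedNorm hW) (by positivity)
  · have h2 : Real.log (2 * d ^ 2 + 1) ≤ 4 * Real.log d := by
      have h3 : Real.log ((d : ℝ) ^ 4) = 4 * Real.log d := by
        rw [Real.log_pow]; norm_num
      rw [← h3]
      have h4 : (4 : ℝ) ≤ d ^ 2 := by nlinarith
      exact Real.log_le_log (by positivity) (by nlinarith)
    rw [mul_pow, mul_pow, Real.sq_sqrt (by positivity)]
    calc (⌊(B / δ) ^ 2⌋₊ : ℝ) * Real.log (2 * d ^ 2 + 1)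
        ≤ (B / δ) ^ 2 * (4 * Real.log d) := by
          gcongr
          · exact Real.log_nonneg (by nlinarith)
          · exact Nat.floor_le (by positivity)
      _ ≤ 2 * ((B / δ) ^ 2 * (4 * Real.log d)) := by
          have : 0 ≤ (B / δ) ^ 2 * (4 * Real.log d) := by positivity
          linarith
      _ = _ := by field_simp; ring

/-! ### Lipschitz continuity of the attention -/

theorem softmax_nonneg {n : ℕ} (v : Fin n → ℝ) (i : Fin n) : 0 ≤ softmax v i := by
  unfold softmax; positivity

theorem sum_softmax {n : ℕ} [NeZero n] (v : Fin n → ℝ) : ∑ i, softmax v i = 1 := by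
  have : 0 < ∑ j, Real.exp (v j) := sum_pos (fun _ _ => Real.exp_pos _) univ_nonempty
  simp only [softmax]
  rw [← sum_div, div_self this.ne']

theorem softmax_sub_le {n : ℕ} [NeZero n] {u v : Fin n → ℝ} {h : ℝ} (huv : ∀ i, |u i - v i| ≤ h)
    (i : Fin n) : softmax u i - softmax v i ≤ 2 * h * softmax u i := by
  have hu : 0 < ∑ j, Real.exp (u j) := sum_pos (fun _ _ => Real.exp_pos _) univ_nonempty
  have hv : 0 < ∑ j, Real.exp (v j) := sum_pos (fun _ _ => Real.exp_pos _) univ_nonempty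
  have h1 : softmax u i * Real.exp (-(2 * h)) ≤ softmax v i := by
    simp only [softmax]
    rw [div_mul_eq_mul_div, div_le_div_iff₀ hu hv]
    have h2 : Real.exp (u i) ≤ Real.exp h * Real.exp (v i) := by
      rw [← Real.exp_add]
      exact Real.exp_le_exp.2 (by linarith [(abs_le.1 (huv i)).2])
    have h3 : ∑ j, Real.exp (v j) ≤ Real.exp h * ∑ j, Real.exp (u j) := by
      rw [mul_sum]
      refine sum_le_sum fun j _ => ?_
      rw [← Real.exp_add]
      exact Real.exp_le_exp.2 (by linarith [(abs_le.1 (huv j)).1])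
    calc _ ≤ Real.exp h * Real.exp (v i) * Real.exp (-(2 * h)) *
          (Real.exp h * ∑ j, Real.exp (u j)) := by gcongr
      _ = Real.exp (h + (-(2 * h)) + h) * (Real.exp (v i) * ∑ j, Real.exp (u j)) := by
          rw [Real.exp_add, Real.exp_add]; ring
      _ = _ := by rw [show h + (-(2 * h)) + h = 0 by ring, Real.exp_zero, one_mul]
  have h4 := mul_le_mul_of_nonneg_left (Real.add_one_le_exp (-(2 * h))) (softmax_nonneg u i)
  linarith

/-- The softmax is Lipschitz from `ℓ_∞` to `ℓ₁`, with a constant independent of the length. -/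
theorem sum_abs_softmax_sub_le {n : ℕ} [NeZero n] {u v : Fin n → ℝ} {h : ℝ}
    (huv : ∀ i, |u i - v i| ≤ h) : ∑ i, |softmax u i - softmax v i| ≤ 4 * h := by
  have hh : 0 ≤ h := (abs_nonneg _).trans (huv 0)
  calc ∑ i, |softmax u i - softmax v i| ≤ ∑ i, (2 * h * softmax u i + 2 * h * softmax v i) := by
        refine sum_le_sum fun i _ => ?_
        have h1 := softmax_sub_le huv i
        have h2 := softmax_sub_le (fun i => by rw [abs_sub_comm]; exact huv i) i (u := v) (v := u)
        have h3 : 0 ≤ 2 * h * softmax u i := mul_nonneg (by positivity) (softmax_nonneg _ _)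
        have h4 : 0 ≤ 2 * h * softmax v i := mul_nonneg (by positivity) (softmax_nonneg _ _)
        exact abs_le.2 ⟨by linarith, by linarith⟩
    _ = 4 * h := by
        rw [sum_add_distrib, ← mul_sum, ← mul_sum, sum_softmax, sum_softmax]; ring

/-- The attention-weighted average `Xᵀ softmax(X W x_cls)` of the rows of `X`. -/
noncomputable def pooled {d T : ℕ} (cls : Fin T) (W : Matrix (Fin d) (Fin d) ℝ)
    (X : Matrix (Fin T) (Fin d) ℝ) : Fin d → ℝ :=
  Xᵀ *ᵥ softmax (X *ᵥ (W *ᵥ X cls))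

theorem abs_pooled_le {d T : ℕ} (cls : Fin T) (W : Matrix (Fin d) (Fin d) ℝ)
    {X : Matrix (Fin T) (Fin d) ℝ} {b : ℝ} (hX : ∀ t, ∑ j, |X t j| ≤ b) (j : Fin d) :
    |pooled cls W X j| ≤ b := by
  have : NeZero T := ⟨fun h => (h ▸ cls).elim0⟩
  calc |pooled cls W X j| ≤ ∑ t, |X t j * softmax (X *ᵥ (W *ᵥ X cls)) t| :=
        abs_sum_le_sum_abs (fun t => X t j * softmax (X *ᵥ (W *ᵥ X cls)) t) univ
    _ ≤ ∑ t, b * softmax (X *ᵥ (W *ᵥ X cls)) t := by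
        refine sum_le_sum fun t _ => ?_
        rw [abs_mul, abs_of_nonneg (softmax_nonneg _ _)]
        exact mul_le_mul_of_nonneg_right ((single_le_sum (f := fun j => |X t j|)
          (fun _ _ => abs_nonneg _) (mem_univ j)).trans (hX t)) (softmax_nonneg _ _)
    _ = b := by rw [← mul_sum, sum_softmax, mul_one]

theorem abs_mulVec_dot_le {d : ℕ} {W : Matrix (Fin d) (Fin d) ℝ} {x z : Fin d → ℝ} {b δ : ℝ}
    (hδ : 0 ≤ δ) (hb : 0 ≤ b) (hW : ∀ i j, |W i j| ≤ δ) (hx : ∑ i, |x i| ≤ b)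
    (hz : ∑ i, |z i| ≤ b) : |x ⬝ᵥ (W *ᵥ z)| ≤ b ^ 2 * δ := by
  have h1 : ∀ i, |(W *ᵥ z) i| ≤ δ * b := fun i =>
    calc |(W *ᵥ z) i| ≤ ∑ j, |W i j * z j| :=
          abs_sum_le_sum_abs (fun j => W i j * z j) univ
      _ ≤ ∑ j, δ * |z j| := sum_le_sum fun j _ => by
          rw [abs_mul]; exact mul_le_mul_of_nonneg_right (hW i j) (abs_nonneg _)
      _ ≤ δ * b := by rw [← mul_sum]; exact mul_le_mul_of_nonneg_left hz hδ
  calc |x ⬝ᵥ (W *ᵥ z)| ≤ ∑ i, |x i * (W *ᵥ z) i| := abs_sum_le_sum_abs _ _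
    _ ≤ ∑ i, |x i| * (δ * b) := sum_le_sum fun i _ => by
        rw [abs_mul]; exact mul_le_mul_of_nonneg_left (h1 i) (abs_nonneg _)
    _ ≤ b * (δ * b) := by
        rw [← sum_mul]; exact mul_le_mul_of_nonneg_right hx (by positivity)
    _ = _ := by ring

/-- The pooled vector depends on `W` in a Lipschitz way for the entrywise maximum norm. -/
theorem abs_pooled_sub_le {d T : ℕ} (cls : Fin T) {W W' : Matrix (Fin d) (Fin d) ℝ}
    {X : Matrix (Fin T) (Fin d) ℝ} {b δ : ℝ} (hδ : 0 ≤ δ) (hb : 0 ≤ b)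
    (hX : ∀ t, ∑ j, |X t j| ≤ b) (hW : ∀ i j, |W i j - W' i j| ≤ δ) (j : Fin d) :
    |pooled cls W X j - pooled cls W' X j| ≤ 4 * b ^ 3 * δ := by
  have : NeZero T := ⟨fun h => (h ▸ cls).elim0⟩
  have hscore : ∀ t, |(X *ᵥ (W *ᵥ X cls)) t - (X *ᵥ (W' *ᵥ X cls)) t| ≤ b ^ 2 * δ := by
    intro t
    have h1 : (X *ᵥ (W *ᵥ X cls)) t - (X *ᵥ (W' *ᵥ X cls)) t = X t ⬝ᵥ ((W - W') *ᵥ X cls) := by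
      rw [Matrix.sub_mulVec, dotProduct_sub]; rfl
    rw [h1]
    exact abs_mulVec_dot_le hδ hb hW (hX t) (hX cls)
  set p := softmax (X *ᵥ (W *ᵥ X cls))
  set p' := softmax (X *ᵥ (W' *ᵥ X cls))
  calc |pooled cls W X j - pooled cls W' X j| = |∑ t, X t j * (p t - p' t)| := by
        simp only [mul_sub, sum_sub_distrib]; rfl
    _ ≤ ∑ t, |X t j * (p t - p' t)| := abs_sum_le_sum_abs _ _
    _ ≤ ∑ t, b * |p t - p' t| := by
        refine sum_le_sum fun t _ => ?_
        rw [abs_mul]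
        exact mul_le_mul_of_nonneg_right ((single_le_sum (f := fun j => |X t j|)
          (fun _ _ => abs_nonneg _) (mem_univ j)).trans (hX t)) (abs_nonneg _)
    _ ≤ b * (4 * (b ^ 2 * δ)) := by
        rw [← mul_sum]; exact mul_le_mul_of_nonneg_left (sum_abs_softmax_sub_le hscore) hb
    _ = _ := by ring

/-! ### The Rademacher complexity of the Transformer class -/

/-- The coordinates of the pooled vectors of a sample, as a process indexed by `W ∈ 𝒲`. -/
noncomputable def pooledProcess {d T m : ℕ} (cls : Fin T) (X : Fin m → Matrix (Fin T) (Fin d) ℝ)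
    (𝒲 : Set (Matrix (Fin d) (Fin d) ℝ)) (W : 𝒲) (j : Fin d) (i : Fin m) : ℝ :=
  pooled cls W.1 (X i) j

theorem abs_sum_mul_le {κ : Type*} [Fintype κ] {u z : κ → ℝ} {B Z : ℝ} (hu : ∑ j, |u j| ≤ B)
    (hZ : 0 ≤ Z) (hz : ∀ j, |z j| ≤ Z) : |∑ j, u j * z j| ≤ B * Z :=
  calc |∑ j, u j * z j| ≤ ∑ j, |u j * z j| := abs_sum_le_sum_abs _ _
    _ ≤ ∑ j, |u j| * Z := sum_le_sum fun j _ => by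
        rw [abs_mul]; exact mul_le_mul_of_nonneg_left (hz j) (abs_nonneg _)
    _ ≤ B * Z := by rw [← sum_mul]; exact mul_le_mul_of_nonneg_right hu hZ

theorem sum_abs_mulVec_le {k d : ℕ} {M : Matrix (Fin k) (Fin d) ℝ} {w : Fin d → ℝ} {Bw Bc : ℝ}
    (hBc : 0 ≤ Bc) (hw : ∑ j, |w j| ≤ Bw) (hM : ∀ j, ∑ a, |M a j| ≤ Bc) :
    ∑ a, |(M *ᵥ w) a| ≤ Bw * Bc :=
  calc ∑ a, |(M *ᵥ w) a| ≤ ∑ a, ∑ j, |M a j * w j| :=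
        sum_le_sum fun a _ => abs_sum_le_sum_abs (fun j => M a j * w j) univ
    _ = ∑ j, |w j| * ∑ a, |M a j| := by
        rw [sum_comm]
        simp only [abs_mul, mul_sum, mul_comm]
    _ ≤ ∑ j, |w j| * Bc := sum_le_sum fun j _ => mul_le_mul_of_nonneg_left (hM j) (abs_nonneg _)
    _ ≤ Bw * Bc := by rw [← sum_mul]; exact mul_le_mul_of_nonneg_right hw hBc

/-- The output layer acts through the vector `W_c w`. -/
theorem transformer_eq {d k T : ℕ} (σ : ℝ → ℝ) (cls : Fin T)
    (w : Fin d → ℝ) (Wc : Matrix (Fin k) (Fin d) ℝ) (Wv : Matrix (Fin d) (Fin k) ℝ)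
    (W : Matrix (Fin d) (Fin d) ℝ) (X : Matrix (Fin T) (Fin d) ℝ) :
    transformer σ cls w Wc Wv W X =
      ∑ a, (Wc *ᵥ w) a * σ (∑ j, Wv j a * pooled cls W X j) := by
  rw [transformer, Matrix.dotProduct_mulVec, Matrix.vecMul_transpose]
  rfl

/-- Peeling off the outer layers: the two outer weight matrices and the value matrix enter through
`ℓ₁` balls, whose extreme points reduce the supremum to single neurons and to single signed
coordinates; in between, the activation is removed by contraction. -/
theorem rademacherLE_transformerClass {d k T m : ℕ} {σ : ℝ → ℝ} {L : ℝ≥0} {Bw Bc Bv b C : ℝ}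
    (cls : Fin T) (X : Fin m → Matrix (Fin T) (Fin d) ℝ) {𝒲 : Set (Matrix (Fin d) (Fin d) ℝ)}
    (h𝒲 : 𝒲.Nonempty) (hd : 0 < d) (hσ : LipschitzWith L σ) (hσ0 : σ 0 = 0)
    (hBw : 0 ≤ Bw) (hBc : 0 ≤ Bc) (hBv : 0 ≤ Bv) (hb : 0 ≤ b)
    (hX : ∀ i t, ∑ j, |X i t j| ≤ b)
    (hC : 𝔼 ε, ⨆ θ, corr ε (signedCoord (pooledProcess cls X 𝒲) θ) ≤ C) :
    RademacherLE (transformerClass d k σ cls Bw Bc Bv 𝒲) X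
      (1 / m * (2 * (Bw * Bc * L * Bv) * C)) := by
  have : Nonempty 𝒲 := h𝒲.to_subtype
  have : Nonempty (Fin d) := ⟨⟨0, hd⟩⟩
  let V := {v : Fin d → ℝ // ∑ j, |v j| ≤ Bv}
  have : Nonempty V := ⟨⟨0, by simpa using hBv⟩⟩
  set y := pooledProcess cls X 𝒲 with hy
  have hyb : ∀ W j i, |y W j i| ≤ b := fun W j i => abs_pooled_le cls W.1 (hX i) j
  let a : V × 𝒲 → Fin m → ℝ := fun θ i => ∑ j, θ.1.1 j * y θ.2 j i
  have hab : ∀ θ i, |a θ i| ≤ Bv * b := fun θ i => abs_sum_mul_le θ.1.2 hb fun j => hyb _ j i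
  have hσab : ∀ θ i, |σ (a θ i)| ≤ L * (Bv * b) := fun θ i => by
    have h1 := hσ.dist_le_mul (a θ i) 0
    rw [Real.dist_eq, Real.dist_eq, hσ0, sub_zero, sub_zero] at h1
    exact h1.trans (mul_le_mul_of_nonneg_left (hab θ i) L.coe_nonneg)
  let U : (Fin m → ℤˣ) → ℝ := fun ε => ⨆ θ, corr ε fun i => σ (a θ i)
  let Z : (Fin m → ℤˣ) → ℝ := fun ε => ⨆ θ, corr ε (signedCoord y θ)
  have hUle : ∀ ε θ, (corr ε fun i => σ (a θ i)) ≤ U ε := fun ε θ =>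
    le_ciSup (bddAbove_corr ε hσab) θ
  have hU0 : ∀ ε, 0 ≤ U ε := fun ε => by
    refine le_trans (le_of_eq ?_) (hUle ε ⟨⟨0, by simpa using hBv⟩, Classical.arbitrary 𝒲⟩)
    simp [a, hσ0, corr]
  have hZle : ∀ ε W j, |corr ε (y W j)| ≤ Z ε := fun ε W j => by
    have hbdd := bddAbove_corr ε (a := signedCoord y) (r := b) fun θ i => by
      rw [abs_signedCoord]; exact hyb _ _ _
    have hs : ∀ s : ℤˣ, ((s : ℤ) : ℝ) * corr ε (y W j) ≤ Z ε := fun s => by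
      rw [← corr_mul_left]
      exact le_ciSup hbdd (W, j, s)
    refine abs_le'.2 ⟨?_, ?_⟩
    · simpa using hs 1
    · simpa using hs (-1)
  have hZ0 : ∀ ε, 0 ≤ Z ε := fun ε =>
    (abs_nonneg _).trans (hZle ε (Classical.arbitrary 𝒲) ⟨0, hd⟩)
  have hpt : ∀ ε, ∀ r ∈ signedSum X ε '' transformerClass d k σ cls Bw Bc Bv 𝒲,
      r ≤ Bw * Bc * (U ε + U (-ε)) := by
    rintro ε _ ⟨_, ⟨w, Wc, Wv, W, hw, hWc, hWv, hW, rfl⟩, rfl⟩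
    rw [vecNorm_one_eq] at hw
    let θ : Fin k → V × 𝒲 := fun c => (⟨fun j => Wv j c, sum_abs_col_le hWv c⟩, ⟨W, hW⟩)
    have h1 : signedSum X ε (transformer σ cls w Wc Wv W) =
        ∑ c, (Wc *ᵥ w) c * corr ε fun i => σ (a (θ c) i) := by
      rw [← corr_sum_mul]
      simp only [signedSum, transformer_eq]
      rfl
    rw [h1]
    refine (le_abs_self _).trans (abs_sum_mul_le
      (sum_abs_mulVec_le hBc hw fun j => sum_abs_col_le hWc j)
      (add_nonneg (hU0 _) (hU0 _)) fun c => abs_le'.2 ⟨?_, ?_⟩)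
    · linarith [hUle ε (θ c), hU0 (-ε)]
    · rw [← corr_neg_left]
      linarith [hUle (-ε) (θ c), hU0 ε]
  refine ⟨fun ε => ⟨_, hpt ε⟩, ?_⟩
  rw [rademacher]
  refine mul_le_mul_of_nonneg_left ?_ (by positivity)
  have hUZ : 𝔼 ε, U ε ≤ L * (Bv * C) := by
    refine (expect_iSup_contraction hσ a hab).trans
      (mul_le_mul_of_nonneg_left ?_ L.coe_nonneg)
    refine le_trans ?_ (mul_le_mul_of_nonneg_left hC hBv)
    rw [mul_expect]
    refine expect_mono fun ε => ciSup_le fun θ => ?_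
    rw [corr_sum_mul]
    exact (le_abs_self _).trans (abs_sum_mul_le θ.1.2 (hZ0 ε) fun j => hZle ε _ j)
  calc 𝔼 ε, sSup (signedSum X ε '' transformerClass d k σ cls Bw Bc Bv 𝒲)
      ≤ 𝔼 ε, Bw * Bc * (U ε + U (-ε)) := expect_mono fun ε => Real.sSup_le (hpt ε)
        (mul_nonneg (mul_nonneg hBw hBc) (add_nonneg (hU0 _) (hU0 _)))
    _ = Bw * Bc * (2 * 𝔼 ε, U ε) := by
        rw [← mul_expect, expect_add_distrib, expect_neg_signs U, two_mul]
    _ ≤ Bw * Bc * (2 * (L * (Bv * C))) := by gcongr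
    _ = _ := by ring

theorem expect_iSup_pooledProcess_le {d T m : ℕ} (cls : Fin T)
    (X : Fin m → Matrix (Fin T) (Fin d) ℝ) {𝒲 : Set (Matrix (Fin d) (Fin d) ℝ)}
    (h𝒲 : 𝒲.Nonempty) (hm : 0 < m) (hd : 0 < d) {b α : ℝ} (hb : 0 < b) (hα : 0 < α)
    (hX : ∀ i t, ∑ j, |X i t j| ≤ b) (hent : MaxEntropyLE 𝒲 α) :
    𝔼 ε, ⨆ θ, corr ε (signedCoord (pooledProcess cls X 𝒲) θ) ≤
      13 * (√m * (4 * b ^ 3 * α) * (1 + max 0 (Real.log (b * √m / (4 * b ^ 3 * α)))) +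
        b * √(m * Real.log (2 * d))) := by
  classical
  have : Nonempty 𝒲 := h𝒲.to_subtype
  refine expect_iSup_signedCoord_le hm hd _ (by positivity) hb
    (fun W j i => abs_pooled_le cls W.1 (hX i) j) fun δ hδ => ?_
  obtain ⟨π, N, hN, hπ⟩ := hent (δ / (4 * b ^ 3)) (by positivity)
  refine ⟨fun W j i => pooled cls (π W) (X i) j,
    N.image fun P j i => pooled cls P (X i) j,
    fun W => mem_image.2 ⟨π W, (hπ W.1 W.2).1, rfl⟩, ?_, fun W j i => ?_⟩
  · refine le_trans (by exact_mod_cast card_image_le) (hN.trans (le_of_eq ?_))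
    congr 1
    field_simp
  · refine (abs_pooled_sub_le cls (by positivity) hb.le (hX i) (hπ W.1 W.2).2 j).trans
      (le_of_eq ?_)
    field_simp

/-- The sample size dominates `2 ln(2d)`, so that subtracting `√(ln(2d))` from `√m` loses only a
constant factor. -/
theorem sqrt_div_four_le {d m : ℕ} (hd : 1 ≤ d) (hdm : d < m) :
    √(m : ℝ) / 4 ≤ √(m : ℝ) - √(Real.log (2 * d)) := by
  have hd' : (1 : ℝ) ≤ d := by exact_mod_cast hd
  have hdm' : (d : ℝ) + 1 ≤ m := by exact_mod_cast hdm
  -- the tangent to the logarithm at `2`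
  have h1 : Real.log (2 * d) ≤ m / 2 := by
    have h2 : Real.log (2 * d) = Real.log (d / 2) + 2 * Real.log 2 := by
      rw [Real.log_mul (by norm_num) (by positivity), Real.log_div (by positivity) (by norm_num)]
      ring
    have h3 := Real.log_le_sub_one_of_pos (show (0 : ℝ) < d / 2 by positivity)
    linarith [Real.log_two_lt_d9]
  have h4 : √(Real.log (2 * d)) ≤ 3 / 4 * √m := by
    rw [show (3 / 4 : ℝ) * √m = √((3 / 4) ^ 2 * m) by
      rw [Real.sqrt_mul (by norm_num), Real.sqrt_sq (by norm_num)]]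
    exact Real.sqrt_le_sqrt (by linarith)
  linarith

/-- The Rademacher bound for any class of attention matrices whose metric entropy in the entrywise
maximum norm is at most `α² / δ²`. -/
theorem rademacherLE_of_maxEntropyLE {d k T m : ℕ} {σ : ℝ → ℝ} {L : ℝ≥0} {Bw Bc Bv b α : ℝ}
    (cls : Fin T) (X : Fin m → Matrix (Fin T) (Fin d) ℝ) {𝒲 : Set (Matrix (Fin d) (Fin d) ℝ)}
    (h𝒲 : 𝒲.Nonempty) (hd : 1 ≤ d) (hdm : d < m) (hσ : LipschitzWith L σ) (hσ0 : σ 0 = 0)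
    (hBw : 0 ≤ Bw) (hBc : 0 ≤ Bc) (hBv : 0 ≤ Bv) (hb : 0 < b) (hα : 0 < α)
    (hX : ∀ i t, vecNorm 1 (X i t) ≤ b) (hent : MaxEntropyLE 𝒲 α) :
    RademacherLE (transformerClass d k σ cls Bw Bc Bv 𝒲) X
      (104 * rate d m (Bw * Bc * L * Bv) b α) := by
  have hm : 0 < m := by omega
  have hm' : (0 : ℝ) < m := by exact_mod_cast hm
  simp only [vecNorm_one_eq] at hX
  obtain ⟨h1, h2⟩ := rademacherLE_transformerClass (k := k) cls X h𝒲 hd hσ hσ0 hBw hBc hBv hb.le hX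
    (expect_iSup_pooledProcess_le cls X h𝒲 hm hd hb hα hX hent)
  refine ⟨h1, h2.trans ?_⟩
  have hlog : max 0 (Real.log (b * √m / (4 * b ^ 3 * α))) ≤
      max 0 (Real.log ((√(m : ℝ) - √(Real.log (2 * d))) / (b ^ 2 * α))) := by
    refine max_le_max le_rfl (Real.log_le_log (by positivity) ?_)
    have h3 : b * √m / (4 * b ^ 3 * α) = √m / 4 / (b ^ 2 * α) := by field_simp
    rw [h3]
    exact div_le_div_of_nonneg_right (sqrt_div_four_le hd hdm) (by positivity)
  have hsq : √(m : ℝ) / m = 1 / √m := Real.sqrt_div_self'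
  have hsq' : √(m * Real.log (2 * d)) / m = √(Real.log (2 * d) / m) := by
    rw [Real.sqrt_mul hm'.le, Real.sqrt_div' _ hm'.le, mul_comm, mul_div_assoc, hsq, mul_one_div]
  set l := max 0 (Real.log (b * √m / (4 * b ^ 3 * α)))
  set l' := max 0 (Real.log ((√(m : ℝ) - √(Real.log (2 * d))) / (b ^ 2 * α))) with hl'
  set q := √(Real.log (2 * d) / m)
  have h3 : 1 / (m : ℝ) * (2 * (Bw * Bc * L * Bv) * (13 * (√m * (4 * b ^ 3 * α) * (1 + l) +
      b * √(m * Real.log (2 * d))))) =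
      (Bw * Bc * L * Bv) * (104 * (b ^ 3 * α * (√m / m) * (1 + l)) +
        26 * (b * (√(m * Real.log (2 * d)) / m))) := by
    field_simp
    ring
  rw [h3, hsq, hsq', rate, ← hl', mul_left_comm 104 (Bw * Bc * L * Bv)]
  refine mul_le_mul_of_nonneg_left ?_ (by positivity)
  have h4 : b ^ 3 * α * (1 / √m) * (1 + l) ≤ b ^ 3 * α / √m * (1 + l') := by
    rw [mul_one_div]
    gcongr
  have h5 : 0 ≤ b * q := by positivity
  linarith

theorem mixedNorm_zero {r s : ℕ} (q p : ℝ≥0∞) (hq : 1 ≤ q) (hp : 1 ≤ p) :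
    mixedNorm q p (0 : Matrix (Fin r) (Fin s) ℝ) = 0 := by
  have : Fact (1 ≤ q) := ⟨hq⟩
  have : Fact (1 ≤ p) := ⟨hp⟩
  have h0 : ∀ (n : ℕ) (q : ℝ≥0∞) [Fact (1 ≤ q)], vecNorm q (fun _ : Fin n => (0 : ℝ)) = 0 :=
    fun n q _ => norm_zero (E := PiLp q fun _ : Fin n => ℝ)
  simp [mixedNorm, h0]

end AttnRad

theorem mainTheorem8 :
    ∃ c : ℝ, 0 < c ∧
      ∀ (d k T m : ℕ) (σ : ℝ → ℝ) (Lσ : ℝ≥0) (Bw Bc Bv Bqk Bx : ℝ) (cls : Fin T)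
        (X : Fin m → Matrix (Fin T) (Fin d) ℝ),
        1 ≤ d → d < m → Real.log (2 * d) < m →
        LipschitzWith Lσ σ → σ 0 = 0 →
        0 ≤ Bw → 0 ≤ Bc → 0 ≤ Bv → 0 < Bqk → 0 < Bx →
        (∀ i t, AttnRad.vecNorm 1 (X i t) ≤ Bx) →
        -- the bound for `‖W_QK‖_{1,∞} ≤ Bqk`, with `W_QK` and with its transpose in the softmax
        (∀ α : ℝ, α = 2 * Bqk * √(d * Real.log (2 * d + 1)) →
          AttnRad.RademacherLE
            (AttnRad.transformerClass d k σ cls Bw Bc Bv {W | AttnRad.mixedNorm 1 ∞ W ≤ Bqk})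
            X (c * AttnRad.rate d m (Bw * Bc * Lσ * Bv) Bx α) ∧
          AttnRad.RademacherLE
            (AttnRad.transformerClass d k σ cls Bw Bc Bv {W | AttnRad.mixedNorm 1 ∞ Wᵀ ≤ Bqk})
            X (c * AttnRad.rate d m (Bw * Bc * Lσ * Bv) Bx α)) ∧
        -- the bound for `‖W_QK‖_{2,1} ≤ Bqk`, with `W_QK` and with its transpose in the softmax
        (2 ≤ d → ∀ α : ℝ, α = 2 * Bqk * √(2 * Real.log d) →
          AttnRad.RademacherLE
            (AttnRad.transformerClass d k σ cls Bw Bc Bv {W | AttnRad.mixedNorm 2 1 W ≤ Bqk})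
            X (c * AttnRad.rate d m (Bw * Bc * Lσ * Bv) Bx α) ∧
          AttnRad.RademacherLE
            (AttnRad.transformerClass d k σ cls Bw Bc Bv {W | AttnRad.mixedNorm 2 1 Wᵀ ≤ Bqk})
            X (c * AttnRad.rate d m (Bw * Bc * Lσ * Bv) Bx α)) := by
  refine ⟨104, by norm_num, ?_⟩
  intro d k T m σ Lσ Bw Bc Bv Bqk Bx cls X hd hdm _ hσ hσ0 hBw hBc hBv hBqk hBx hX
  have hd' : (1 : ℝ) ≤ d := by exact_mod_cast hd
  refine ⟨?_, ?_⟩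
  · rintro α rfl
    have hα : 0 < 2 * Bqk * √(d * Real.log (2 * d + 1)) := by
      have : 0 < Real.log (2 * d + 1) := Real.log_pos (by linarith)
      positivity
    have h0 : AttnRad.mixedNorm 1 ∞ (0 : Matrix (Fin d) (Fin d) ℝ) ≤ Bqk := by
      rw [AttnRad.mixedNorm_zero 1 ∞ le_rfl le_top]; exact hBqk.le
    have hent := AttnRad.maxEntropyLE_mixedNorm_one_top hd hBqk
    exact ⟨AttnRad.rademacherLE_of_maxEntropyLE cls X ⟨0, h0⟩ hd hdm hσ hσ0 hBw hBc hBv hBx hα hX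
        hent,
      AttnRad.rademacherLE_of_maxEntropyLE cls X ⟨0, by simpa using h0⟩ hd hdm hσ hσ0 hBw hBc hBv
        hBx hα hX hent.transpose⟩
  · rintro hd2 α rfl
    have hα : 0 < 2 * Bqk * √(2 * Real.log d) := by
      have : 0 < Real.log d := Real.log_pos (by exact_mod_cast hd2)
      positivity
    have h0 : AttnRad.mixedNorm 2 1 (0 : Matrix (Fin d) (Fin d) ℝ) ≤ Bqk := by
      rw [AttnRad.mixedNorm_zero 2 1 one_le_two le_rfl]; exact hBqk.le
    have hent := AttnRad.maxEntropyLE_mixedNorm_two_one hd2 (B := Bqk)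
    exact ⟨AttnRad.rademacherLE_of_maxEntropyLE cls X ⟨0, h0⟩ hd hdm hσ hσ0 hBw hBc hBv hBx hα hX
        hent,
      AttnRad.rademacherLE_of_maxEntropyLE cls X ⟨0, by simpa using h0⟩ hd hdm hσ hσ0 hBw hBc hBv
        hBx hα hX hent.transpose⟩
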